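/- Let $X$ be a non-empty compact metrizable space, $T:X\to X$ a homeomorphism, $\varphi:X\to\mathbb R$ a continuous function and $d$ a metric on $X$ compatible with the topology. Then $$\mathrm{mdim}(X,T,\varphi)\ \le\ \mathrm{mdim}_{\mathrm H}(X,T,d,\varphi)\ \le\ \underline{\mathrm{mdim}}_{\mathrm M}(X,T,d,\varphi),$$ where the three quantities, with values in $[-\infty,\infty]$, are defined as follows. For $N>0$ put $d_N(x,y)=\max_{0\le n<N}d(T^nx,T^ny)$ and $S_N\varphi(x)=\sum_{n=0}^{N-1}\varphi(T^nx)$. Logarithms are to base two. Let $\rho$ be a compatible metric on $X$, $\psi:X\to\mathbb R$ continuous and $\varepsilon>0$; diameters are taken with respect to $\rho$. * **Mean dimension.** For a finite simplicial complex $P$ and $a\in P$ let $\dim_aP$ be the maximal dimension of a simplex of $P$ containing $a$. Let $\mathrm{Widim}_\varepsilon(X,\rho,\psi)$ be the infimum of $\max_{x\in X}\left(\dim_{f(x)}P+\psi(x)\right)$ over all finite simplicial complexes $P$ and all continuous maps $f:X\to P$ with $\mathrm{diam}\,f^{-1}(y)<\varepsilon$ for every $y\in P$. Then $$\mathrm{mdim}(X,T,\varphi)=\lim_{\varepsilon\to0}\lim_{N\to\infty}\frac{\mathrm{Widim}_\varepsilon(X,d'_N,S_N\varphi)}{N},$$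 where $d'$ is any metric on $X$ compatible with the topology (the value does not depend on its choice, so $d'$ need not be the metric $d$ above). * **Mean Hausdorff dimension.** For $s\ge\max_X\psi$ let $\mathcal H^s_\varepsilon(X,\rho,\psi)$ be the infimum of $\sum_{i=1}^\infty(\mathrm{diam}\,E_i)^{s-\sup_{E_i}\psi}$ over all countable covers $X=\bigcup_{i\ge1}E_i$ with $\mathrm{diam}\,E_i<\varepsilon$ for all $i$; here $0^0=1$ and empty sets $E_i$ contribute $0$. Let $\dim_{\mathrm H}(X,\rho,\psi,\varepsilon)$ be the supremum of the real numbers $s\ge\max_X\psi$ with $\mathcal H^s_\varepsilon(X,\rho,\psi)\ge1$. Then $$\mathrm{mdim}_{\mathrm H}(X,T,d,\varphi)=\lim_{\varepsilon\to0}\limsup_{N\to\infty}\frac{\dim_{\mathrm H}(X,d_N,S_N\varphi,\varepsilon)}{N}.$$ * **Lower metric mean dimension.** Let $\#(X,\rho,\psi,\varepsilon)$ be the infimum of $\sum_{i=1}^n(1/\varepsilon)^{\sup_{U_i}\psi}$ over all finite open covers $X=U_1\cup\dots\cup U_n$ with $\mathrm{diam}\,U_i<\varepsilon$ for all $i$ (empty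 members contribute $0$). Then $$\underline{\mathrm{mdim}}_{\mathrm M}(X,T,d,\varphi)=\liminf_{\varepsilon\to0}\frac{1}{\log(1/\varepsilon)}\lim_{N\to\infty}\frac{\log\#(X,d_N,S_N\varphi,\varepsilon)}{N}.$$ All limits written above exist: those over $N$ by subadditivity, those over $\varepsilon$ by monotonicity. -/

import Mathlib

open Set Filter Topology
open scoped ENNReal

noncomputable section

namespace MeanDim

variable {X : Type*}

/-- `d` is a metric (distance function) on `X` that induces the topology of `X`. -/
structure IsCompatibleMetric [TopologicalSpace X] (d : X → X → ℝ) : Prop where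
  eq_zero_iff : ∀ x y, d x y = 0 ↔ x = y
  symm : ∀ x y, d x y = d y x
  triangle : ∀ x y z, d x z ≤ d x y + d y z
  isOpen_iff : ∀ s : Set X, IsOpen s ↔ ∀ x ∈ s, ∃ r > 0, ∀ y, d x y < r → y ∈ s

/-- Diameter of `E` with respect to `d`, as an element of `[0, ∞]`; the empty set has
diameter `0`. -/
def diam (d : X → X → ℝ) (E : Set X) : ℝ≥0∞ :=
  ⨆ x ∈ E, ⨆ y ∈ E, ENNReal.ofReal (d x y)

/-- The dynamical metric `d_N(x, y) = max_{0 ≤ n < N} d(Tⁿ x, Tⁿ y)` (used for `N > 0`). -/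
def dynMetric (d : X → X → ℝ) (T : X → X) (N : ℕ) (x y : X) : ℝ :=
  ⨆ n : Fin N, d (T^[n] x) (T^[n] y)

/-- The local dimension `dim_a P`: the maximal dimension of a simplex of `P` containing the
point `a` of `P`. A face is given by its vertex set `s` and has dimension `#s - 1`. -/
def localDim {n : ℕ} (P : Geometry.SimplicialComplex ℝ (Fin n → ℝ)) (a : Fin n → ℝ) : ℕ :=
  sSup {k : ℕ | ∃ s ∈ P.faces, a ∈ convexHull ℝ (s : Set (Fin n → ℝ)) ∧ s.card = k + 1}

/-- A map is an `ε`-embedding if all its fibres have `d`-diameter less than `ε`. -/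
def IsEpsEmbedding {Y : Type*} (d : X → X → ℝ) (ε : ℝ) (f : X → Y) : Prop :=
  ∀ y : Y, diam d (f ⁻¹' {y}) < ENNReal.ofReal ε

/-- The `ε`-width dimension with potential: the infimum of `max_x (dim_{f x} P + φ x)` over all
continuous `ε`-embeddings `f` of `X` into finite simplicial complexes `P` (geometrically realized
in some `ℝⁿ`). -/
def widim [TopologicalSpace X] (d : X → X → ℝ) (φ : X → ℝ) (ε : ℝ) : EReal :=
  ⨅ (n : ℕ) (P : Geometry.SimplicialComplex ℝ (Fin n → ℝ)) (_ : P.faces.Finite)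
    (f : C(X, P.space)) (_ : IsEpsEmbedding d ε f),
    ⨆ x : X, (((localDim P (f x : Fin n → ℝ) : ℝ) + φ x : ℝ) : EReal)

/-- The mean dimension with potential
`lim_{ε → 0} lim_{N → ∞} widim_ε(X, d_N, S_N φ) / N`, computed with the metric `d`. The inner
limit exists by subadditivity in `N` and the outer one by monotonicity in `ε`; both limits are
written as upper limits. -/
def mdim [TopologicalSpace X] (d : X → X → ℝ) (T : X → X) (φ : X → ℝ) : EReal :=
  limsup (fun ε : ℝ =>
    limsup (fun N : ℕ => widim (dynMetric d T N) (birkhoffSum T φ N) ε / (N : EReal)) atTop)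
    (𝓝[>] 0)

/-- The covering number with potential: the infimum of `∑ i, (1/ε) ^ (sup_{U i} φ)` over all finite
open covers of `X` by sets of diameter less than `ε`. Empty members contribute `0`, that is, they
may be dropped from the cover. -/
def coveringNumber [TopologicalSpace X] (d : X → X → ℝ) (φ : X → ℝ) (ε : ℝ) : ℝ≥0∞ :=
  ⨅ (n : ℕ) (U : Fin n → Set X) (_ : ∀ i, IsOpen (U i)) (_ : ⋃ i, U i = univ)
    (_ : ∀ i, diam d (U i) < ENNReal.ofReal ε),
    ∑ i, ⨆ _ : (U i).Nonempty, ENNReal.ofReal ((1 / ε) ^ sSup (φ '' U i))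

/-- Logarithm to base two on `[0, ∞]`. -/
def log₂ (a : ℝ≥0∞) : EReal := ENNReal.log a / ((Real.log 2 : ℝ) : EReal)

/-- `P(X, T, d, φ, ε) = lim_{N → ∞} log #(X, d_N, S_N φ, ε) / N`. The limit exists by
subadditivity in `N`; it is written as a lower limit. -/
def pressure [TopologicalSpace X] (d : X → X → ℝ) (T : X → X) (φ : X → ℝ) (ε : ℝ) : EReal :=
  liminf (fun N : ℕ =>
    log₂ (coveringNumber (dynMetric d T N) (birkhoffSum T φ N) ε) / (N : EReal)) atTop

/-- The lower metric mean dimension with potential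
`liminf_{ε → 0} P(X, T, d, φ, ε) / log (1/ε)`. -/
def lowerMdimM [TopologicalSpace X] (d : X → X → ℝ) (T : X → X) (φ : X → ℝ) : EReal :=
  liminf (fun ε : ℝ => pressure d T φ ε / ((Real.logb 2 (1 / ε) : ℝ) : EReal)) (𝓝[>] 0)

/-- `ℋ^s_ε(X, d, φ)`: the infimum of `∑ i, (diam (E i)) ^ (s - sup_{E i} φ)` over all countable
covers of `X` by sets of diameter less than `ε`, for `s ≥ max φ`. Here `0 ^ 0 = 1`, and the empty
set contributes `0`. -/
def hausdorffContent (d : X → X → ℝ) (φ : X → ℝ) (s ε : ℝ) : ℝ≥0∞ :=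
  ⨅ (E : ℕ → Set X) (_ : ⋃ i, E i = univ) (_ : ∀ i, diam d (E i) < ENNReal.ofReal ε),
    ∑' i, ⨆ _ : (E i).Nonempty, diam d (E i) ^ (s - sSup (φ '' E i))

/-- `dim_H(X, d, φ, ε)`: the supremum of the real numbers `s ≥ max φ` with
`ℋ^s_ε(X, d, φ) ≥ 1`. -/
def dimH (d : X → X → ℝ) (φ : X → ℝ) (ε : ℝ) : EReal :=
  ⨆ (s : ℝ) (_ : ∀ x, φ x ≤ s) (_ : 1 ≤ hausdorffContent d φ s ε), (s : EReal)

/-- The mean Hausdorff dimension with potential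
`lim_{ε → 0} limsup_{N → ∞} dim_H(X, d_N, S_N φ, ε) / N`. The outer limit exists by monotonicity
in `ε`; it is written as an upper limit. -/
def mdimH (d : X → X → ℝ) (T : X → X) (φ : X → ℝ) : EReal :=
  limsup (fun ε : ℝ =>
    limsup (fun N : ℕ => dimH (dynMetric d T N) (birkhoffSum T φ N) ε / (N : EReal)) atTop)
    (𝓝[>] 0)

end MeanDim

end

/-! Second inequality: if `diam E < ε` and `s ≥ sup ψ`, then `(diam E)^(s - sup_E ψ)` is at most
`ε^s (1/ε)^(sup_E ψ)`. Hence `ℋ^s_ε ≤ ε^s #(ε)` and `dim_H ≤ log # / log (1/ε)` at each scale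
(`dimH_le_log_coveringNumber`). Fekete's lemma turns the pressure into a true limit in `N`, and
monotonicity in `ε` lets the limsup on the left be compared with the liminf on the right.

First inequality: the functions `F (z, n) x = d (Tⁿ x) z / r`, with `z` in a finite net, are
`1/r`-Lipschitz for `d_N` and together locate the orbit of `x`. Draw a threshold `c a ∈ [1, 2]` for
each of them at random. A set of diameter `δ` can hit a given set of `k` thresholds only with
probability at most `(δ/r)^k`. So, when `ℋ^s_ε' < 1`, a union bound yields one choice of `c` with
`#{a | F a x = c a} + ψ x < s + b` at every `x` (`exists_thresholds`).

Let each `F a` climb from 0 to 1 in a thin window around `c a`. This maps `X` to a cube, and at each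
point few coordinates lie strictly between 0 and 1. Passing to a complex modelled on the Freudenthal
triangulation of the cube gives an `ε`-embedding whose local dimension is bounded by that number of
coordinates (`widim_le_of_thresholds`).

The losses are linear in `N` with small slope: the combinatorial factor is `C^N` with `C` fixed
before `ε'`, so a small `ε'` absorbs it, and the oscillation of `S_N φ` is controlled by uniform
continuity of `φ`. -/

namespace MeanDim

variable {X : Type*}

/-! ### Compatible metrics and uniformity near the diagonal. -/

namespace IsCompatibleMetric

variable [TopologicalSpace X] {d : X → X → ℝ}

/-- The metric space structure given by a compatible metric; its topology is the given one. -/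
abbrev metricSpace (hd : IsCompatibleMetric d) : MetricSpace X :=
  MetricSpace.ofDistTopology d (fun x => (hd.eq_zero_iff x x).2 rfl) hd.symm hd.triangle
    hd.isOpen_iff (fun x y => (hd.eq_zero_iff x y).1)

theorem self_eq_zero (hd : IsCompatibleMetric d) (x : X) : d x x = 0 :=
  (hd.eq_zero_iff x x).2 rfl

theorem continuous_uncurry (hd : IsCompatibleMetric d) :
    Continuous fun p : X × X => d p.1 p.2 :=
  let := hd.metricSpace
  continuous_dist

/-- By compactness, neighbourhoods of the diagonal are entourages. This serves both to pass from `d`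
to `d'` and to control the oscillation of `φ`. -/
theorem exists_forall_lt [CompactSpace X] (hd : IsCompatibleMetric d) {u : X × X → ℝ}
    (hu : Continuous u) (h0 : ∀ x, u (x, x) = 0) {ε : ℝ} (hε : 0 < ε) :
    ∃ ρ > 0, ∀ x y, d x y < ρ → u (x, y) < ε := by
  let := hd.metricSpace
  have hopen : IsOpen {p : X × X | u p < ε} := isOpen_lt hu continuous_const
  have hmem : {p : X × X | u p < ε} ∈ uniformity X := by
    rw [← nhdsSet_diagonal_eq_uniformity]
    refine hopen.mem_nhdsSet.2 ?_
    rintro ⟨x, y⟩ hxy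
    obtain rfl : x = y := hxy
    simpa [h0] using hε
  obtain ⟨ρ, hρ, h⟩ := Metric.mem_uniformity_dist.1 hmem
  exact ⟨ρ, hρ, fun x y hxy => h hxy⟩

theorem exists_finset_net [CompactSpace X] (hd : IsCompatibleMetric d) {r : ℝ} (hr : 0 < r) :
    ∃ t : Finset X, ∀ x, ∃ y ∈ t, d x y < r := by
  let := hd.metricSpace
  obtain ⟨t, -, ht, h⟩ := (isCompact_univ (X := X)).finite_cover_balls hr
  refine ⟨ht.toFinset, fun x => ?_⟩
  have hx := h (mem_univ x)
  simp only [mem_iUnion, Metric.mem_ball] at hx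
  obtain ⟨y, hy, hxy⟩ := hx
  exact ⟨y, ht.mem_toFinset.2 hy, hxy⟩

end IsCompatibleMetric

/-! ### Diameters, dynamical metrics and Birkhoff sums. -/

section Diam

variable {d : X → X → ℝ}

theorem diam_empty : diam d ∅ = 0 := by simp [diam]

theorem ofReal_le_diam {E : Set X} {x y : X} (hx : x ∈ E) (hy : y ∈ E) :
    ENNReal.ofReal (d x y) ≤ diam d E :=
  le_iSup₂_of_le x hx (le_iSup₂_of_le y hy le_rfl)

theorem diam_le {E : Set X} {a : ℝ≥0∞}
    (h : ∀ x ∈ E, ∀ y ∈ E, ENNReal.ofReal (d x y) ≤ a) : diam d E ≤ a :=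
  iSup₂_le fun x hx => iSup₂_le fun y hy => h x hx y hy

theorem diam_lt_ofReal {E : Set X} {a b : ℝ} (hab : a < b) (hb : 0 < b)
    (h : ∀ x ∈ E, ∀ y ∈ E, d x y ≤ a) : diam d E < ENNReal.ofReal b :=
  (diam_le fun x hx y hy => ENNReal.ofReal_le_ofReal (h x hx y hy)).trans_lt
    ((ENNReal.ofReal_lt_ofReal_iff hb).2 hab)

variable (T : X → X)

theorem le_dynMetric {N n : ℕ} (hn : n < N) (x y : X) :
    d (T^[n] x) (T^[n] y) ≤ dynMetric d T N x y :=
  le_ciSup (f := fun n : Fin N => d (T^[n] x) (T^[n] y)) (Set.finite_range _).bddAbove ⟨n, hn⟩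

theorem dynMetric_le {N : ℕ} {x y : X} {a : ℝ} (ha : 0 ≤ a)
    (h : ∀ n < N, d (T^[n] x) (T^[n] y) ≤ a) : dynMetric d T N x y ≤ a :=
  Real.iSup_le (fun n => h n n.2) ha

theorem continuous_birkhoffSum [TopologicalSpace X] {T : X → X} (hT : Continuous T) {φ : X → ℝ}
    (hφ : Continuous φ) (N : ℕ) : Continuous (birkhoffSum T φ N) :=
  continuous_finsetSum _ fun n _ => hφ.comp (hT.iterate n)

end Diam

/-! ### Monotonicity in the scale. -/

section Antitone

theorem hausdorffContent_anti {d : X → X → ℝ} {ψ : X → ℝ} (s : ℝ) :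
    Antitone (hausdorffContent d ψ s) := by
  intro ε ε' h
  refine le_iInf₂ fun E hE => le_iInf fun hdiam => iInf₂_le_of_le E hE (iInf_le _ fun i => ?_)
  exact (hdiam i).trans_le (ENNReal.ofReal_le_ofReal h)

theorem dimH_anti {d : X → X → ℝ} {ψ : X → ℝ} : Antitone (dimH d ψ) := by
  intro ε ε' h
  exact iSup_mono fun s => iSup_mono fun _ =>
    iSup_le fun h1 => le_iSup_of_le (h1.trans (hausdorffContent_anti s h)) le_rfl

theorem limsup_dimH_anti {d : X → X → ℝ} {T : X → X} {φ : X → ℝ} :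
    Antitone fun ε : ℝ => limsup
      (fun N : ℕ => dimH (dynMetric d T N) (birkhoffSum T φ N) ε / (N : EReal)) atTop :=
  fun _ _ h => limsup_le_limsup (Eventually.of_forall fun _ =>
    EReal.div_le_div_right_of_nonneg (Nat.cast_nonneg' _) (dimH_anti h))

end Antitone

/-! ### Hausdorff content against covering numbers at a fixed scale. -/

section UpperBound

variable [TopologicalSpace X] {d : X → X → ℝ} {ψ : X → ℝ} {ε : ℝ}

theorem coveringNumber_le {ι : Type*} [Fintype ι] (U : ι → Set X) (hU : ∀ i, IsOpen (U i))
    (hcov : ⋃ i, U i = univ) (hdiam : ∀ i, diam d (U i) < ENNReal.ofReal ε) :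
    coveringNumber d ψ ε ≤
      ∑ i, ⨆ _ : (U i).Nonempty, ENNReal.ofReal ((1 / ε) ^ sSup (ψ '' U i)) := by
  let e := Fintype.equivFin ι
  refine (iInf₂_le (Fintype.card ι) (U ∘ e.symm)).trans ?_
  refine (iInf₂_le (fun i => hU _) ?_).trans ((iInf_le _ fun i => hdiam _).trans_eq ?_)
  · rw [← hcov]
    exact e.symm.surjective.iUnion_comp U
  · exact e.symm.sum_comp fun i =>
      ⨆ _ : (U i).Nonempty, ENNReal.ofReal ((1 / ε) ^ sSup (ψ '' U i))

theorem exists_cover_of_coveringNumber_lt {a : ℝ≥0∞} (h : coveringNumber d ψ ε < a) :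
    ∃ (n : ℕ) (U : Fin n → Set X), (∀ i, IsOpen (U i)) ∧ ⋃ i, U i = univ ∧
      (∀ i, diam d (U i) < ENNReal.ofReal ε) ∧
      ∑ i, ⨆ _ : (U i).Nonempty, ENNReal.ofReal ((1 / ε) ^ sSup (ψ '' U i)) < a := by
  simp only [coveringNumber, iInf_lt_iff] at h
  obtain ⟨n, U, h1, h2, h3, h4⟩ := h
  exact ⟨n, U, h1, h2, h3, h4⟩

theorem coveringNumber_lt_top (h : ∃ (n : ℕ) (U : Fin n → Set X), (∀ i, IsOpen (U i)) ∧
    ⋃ i, U i = univ ∧ ∀ i, diam d (U i) < ENNReal.ofReal ε) : coveringNumber d ψ ε < ⊤ := by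
  obtain ⟨n, U, h1, h2, h3⟩ := h
  refine (coveringNumber_le U h1 h2 h3).trans_lt (ENNReal.sum_lt_top.2 fun i _ => ?_)
  exact (iSup_le fun _ => le_rfl).trans_lt ENNReal.ofReal_lt_top

theorem le_coveringNumber [Nonempty X] (hε : 0 < ε) (hε1 : ε ≤ 1) {a : ℝ} (ha : ∀ x, a ≤ ψ x)
    (hb : BddAbove (range ψ)) : ENNReal.ofReal ((1 / ε) ^ a) ≤ coveringNumber d ψ ε := by
  refine le_iInf₂ fun n U => le_iInf₂ fun _ hcov => le_iInf fun _ => ?_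
  obtain ⟨x⟩ := ‹Nonempty X›
  obtain ⟨i, hi⟩ := mem_iUnion.1 (hcov.symm ▸ mem_univ x : x ∈ ⋃ i, U i)
  refine le_trans ?_ (Finset.single_le_sum (fun _ _ => zero_le) (Finset.mem_univ i))
  refine le_iSup_of_le ⟨x, hi⟩ (ENNReal.ofReal_le_ofReal ?_)
  refine Real.rpow_le_rpow_of_exponent_le ((one_le_div hε).2 hε1) ((ha x).trans ?_)
  exact le_csSup (hb.mono (image_subset_range _ _)) (mem_image_of_mem _ hi)

theorem hausdorffContent_le (hε : 0 < ε) {s : ℝ} (hs : ∀ x, ψ x ≤ s) :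
    hausdorffContent d ψ s ε ≤ ENNReal.ofReal (ε ^ s) * coveringNumber d ψ ε := by
  have hne : ENNReal.ofReal (ε ^ s) ≠ 0 := by
    simpa using Real.rpow_pos_of_pos hε s
  rw [mul_comm, ← ENNReal.div_le_iff_le_mul (Or.inl hne) (Or.inl ENNReal.ofReal_ne_top)]
  refine le_iInf₂ fun n U => le_iInf₂ fun hU hcov => le_iInf fun hdiam => ?_
  rw [ENNReal.div_le_iff_le_mul (Or.inl hne) (Or.inl ENNReal.ofReal_ne_top), mul_comm]
  -- The finite cover is padded with empty sets, which contribute nothing.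
  let E : ℕ → Set X := fun i => if h : i < n then U ⟨i, h⟩ else ∅
  have hE : ∀ i : Fin n, E i = U i := fun i => by simp [E]
  have hE0 : ∀ i, i ∉ Finset.range n → E i = ∅ := fun i hi => by simp_all [E]
  refine (iInf₂_le E ?_).trans ((iInf_le _ fun i => ?_).trans ?_)
  · refine eq_univ_of_forall fun x => ?_
    obtain ⟨i, hi⟩ := mem_iUnion.1 (hcov.symm ▸ mem_univ x : x ∈ ⋃ i, U i)
    exact mem_iUnion.2 ⟨i, (hE i).symm ▸ hi⟩
  · by_cases h : i < n
    · simpa [E, h] using hdiam ⟨i, h⟩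
    · simpa [E, h, diam_empty] using hε
  · rw [tsum_eq_sum (s := Finset.range n) fun i hi => by simp [hE0 i hi], Finset.sum_range,
      Finset.mul_sum]
    refine Finset.sum_le_sum fun i _ => ?_
    rw [hE i]
    refine iSup_le fun hne => ?_
    rw [iSup_pos hne, ← ENNReal.ofReal_mul (by positivity), one_div, Real.inv_rpow hε.le,
      ← Real.rpow_neg hε.le, ← Real.rpow_add hε, ← sub_eq_add_neg]
    have hexp : 0 ≤ s - sSup (ψ '' U i) :=
      sub_nonneg.2 (csSup_le (hne.image _) (by rintro _ ⟨x, -, rfl⟩; exact hs x))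
    rw [← ENNReal.ofReal_rpow_of_nonneg hε.le hexp]
    exact ENNReal.rpow_le_rpow (hdiam i).le hexp

theorem dimH_le_log_coveringNumber (hε : 0 < ε) (hε1 : ε < 1) (h0 : coveringNumber d ψ ε ≠ 0)
    (htop : coveringNumber d ψ ε ≠ ⊤) :
    dimH d ψ ε ≤
      ((Real.logb 2 (coveringNumber d ψ ε).toReal / Real.logb 2 (1 / ε) : ℝ) : EReal) := by
  refine iSup_le fun s => iSup₂_le fun hs h1 => EReal.coe_le_coe_iff.2 ?_
  have h2 := h1.trans (hausdorffContent_le hε hs)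
  have hc : 0 < (coveringNumber d ψ ε).toReal := ENNReal.toReal_pos h0 htop
  have h3 : 1 ≤ ε ^ s * (coveringNumber d ψ ε).toReal := by
    have := ENNReal.toReal_mono (ENNReal.mul_ne_top ENNReal.ofReal_ne_top htop) h2
    rwa [ENNReal.toReal_mul, ENNReal.toReal_ofReal (by positivity), ENNReal.toReal_one] at this
  have h4 : 0 ≤ s * Real.logb 2 ε + Real.logb 2 (coveringNumber d ψ ε).toReal := by
    rw [← Real.logb_rpow_eq_mul_logb_of_pos hε,
      ← Real.logb_mul (Real.rpow_pos_of_pos hε s).ne' hc.ne']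
    exact Real.logb_nonneg one_lt_two h3
  have h5 : 0 < Real.logb 2 (1 / ε) := Real.logb_pos one_lt_two (by rwa [lt_div_iff₀ hε, one_mul])
  rw [le_div_iff₀ h5, one_div, Real.logb_inv]
  linarith

theorem log₂_eq_coe_logb {a : ℝ≥0∞} (h0 : a ≠ 0) (htop : a ≠ ⊤) :
    log₂ a = ((Real.logb 2 a.toReal : ℝ) : EReal) := by
  rw [log₂, ENNReal.log_pos_real h0 htop, ← EReal.coe_div, Real.logb]

end UpperBound

/-! ### Subadditivity and the second inequality. -/

section Dynamics

variable [TopologicalSpace X] {d : X → X → ℝ} {T : X → X} {φ : X → ℝ} {ε : ℝ}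

theorem exists_open_cover_dynMetric [CompactSpace X] (hd : IsCompatibleMetric d)
    (hT : Continuous T) (N : ℕ) (hε : 0 < ε) :
    ∃ (n : ℕ) (U : Fin n → Set X), (∀ i, IsOpen (U i)) ∧ ⋃ i, U i = univ ∧
      ∀ i, diam (dynMetric d T N) (U i) < ENNReal.ofReal ε := by
  let V : X → Set X := fun x => ⋂ n : Fin N, {y | d (T^[n] x) (T^[n] y) < ε / 3}
  have hV : ∀ x, IsOpen (V x) := fun x => isOpen_iInter_of_finite fun n =>
    isOpen_lt (hd.continuous_uncurry.comp (continuous_const.prodMk (hT.iterate n)))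
      continuous_const
  obtain ⟨t, ht⟩ := (isCompact_univ (X := X)).elim_finite_subcover V hV fun x _ =>
    mem_iUnion.2 ⟨x, mem_iInter.2 fun n => by simp [hd.self_eq_zero, hε]⟩
  let e := t.equivFin
  refine ⟨t.card, fun i => V (e.symm i), fun i => hV _, eq_univ_of_forall fun x => ?_, fun i => ?_⟩
  · obtain ⟨y, hy, hxy⟩ := mem_iUnion₂.1 (ht (mem_univ x))
    exact mem_iUnion.2 ⟨e ⟨y, hy⟩, by simpa using hxy⟩
  · refine diam_lt_ofReal (a := 2 * ε / 3) (by linarith) hε fun x hx y hy =>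
      dynMetric_le T (by positivity) fun n hn => ?_
    have h1 : d (T^[n] (e.symm i)) (T^[n] x) < ε / 3 := mem_iInter.1 hx ⟨n, hn⟩
    have h2 : d (T^[n] (e.symm i)) (T^[n] y) < ε / 3 := mem_iInter.1 hy ⟨n, hn⟩
    have h3 := hd.triangle (T^[n] x) (T^[n] (e.symm i)) (T^[n] y)
    rw [hd.symm (T^[n] x) (T^[n] (e.symm i))] at h3
    linarith

/-- Join the cover for `M` with the pullback under `T^M` of the cover for `N`. The supremum of a sum
is at most the sum of the suprema, and `1/ε ≥ 1` preserves this in the exponent. -/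
theorem coveringNumber_add_le (hT : Continuous T) (hε : 0 < ε) (hε1 : ε ≤ 1)
    (hb : ∀ N, BddAbove (range (birkhoffSum T φ N))) (M N : ℕ)
    (hM : coveringNumber (dynMetric d T M) (birkhoffSum T φ M) ε ≠ ⊤)
    (hN : coveringNumber (dynMetric d T N) (birkhoffSum T φ N) ε ≠ ⊤) :
    coveringNumber (dynMetric d T (M + N)) (birkhoffSum T φ (M + N)) ε ≤
      coveringNumber (dynMetric d T M) (birkhoffSum T φ M) ε *
        coveringNumber (dynMetric d T N) (birkhoffSum T φ N) ε := by
  refine ENNReal.le_mul_of_forall_lt (Or.inr hN) (Or.inl hM) fun a ha b hb' => ?_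
  obtain ⟨m, U, hU, hUcov, hUd, hUa⟩ := exists_cover_of_coveringNumber_lt ha
  obtain ⟨n, V, hV, hVcov, hVd, hVb⟩ := exists_cover_of_coveringNumber_lt hb'
  refine le_trans ?_ (mul_le_mul' hUa.le hVb.le)
  have hx : ∀ i : Fin m × Fin n, ∀ x ∈ U i.1 ∩ T^[M] ⁻¹' V i.2, ∀ y ∈ U i.1 ∩ T^[M] ⁻¹' V i.2,
      ∀ a, 0 ≤ a → dynMetric d T M x y ≤ a → dynMetric d T N (T^[M] x) (T^[M] y) ≤ a →
      dynMetric d T (M + N) x y ≤ a := by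
    intro i x _ y _ a ha0 h1 h2
    refine dynMetric_le T ha0 fun k hk => ?_
    rcases lt_or_ge k M with h | h
    · exact (le_dynMetric T h x y).trans h1
    · obtain ⟨j, rfl⟩ := Nat.exists_eq_add_of_le h
      have := (le_dynMetric (d := d) T (show j < N by omega) (T^[M] x) (T^[M] y)).trans h2
      rwa [← Function.iterate_add_apply, ← Function.iterate_add_apply, add_comm j M] at this
  refine (coveringNumber_le (fun i : Fin m × Fin n => U i.1 ∩ T^[M] ⁻¹' V i.2)
    (fun i => (hU _).inter ((hV _).preimage (hT.iterate M))) ?_ fun i => ?_).trans ?_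
  · refine eq_univ_of_forall fun x => ?_
    obtain ⟨i, hi⟩ := mem_iUnion.1 (hUcov.symm ▸ mem_univ x : x ∈ ⋃ i, U i)
    obtain ⟨j, hj⟩ := mem_iUnion.1 (hVcov.symm ▸ mem_univ (T^[M] x) : T^[M] x ∈ ⋃ i, V i)
    exact mem_iUnion.2 ⟨(i, j), hi, hj⟩
  · refine lt_of_le_of_lt (diam_le fun x hx' y hy' => ?_) (max_lt (hUd i.1) (hVd i.2))
    set A := diam (dynMetric d T M) (U i.1)
    set B := diam (dynMetric d T N) (V i.2)
    have hA : A < ⊤ := (hUd i.1).trans ENNReal.ofReal_lt_top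
    have hB : B < ⊤ := (hVd i.2).trans ENNReal.ofReal_lt_top
    have hAB : max A B ≠ ⊤ := (max_lt hA hB).ne
    refine ENNReal.ofReal_le_of_le_toReal (hx i x hx' y hy' _ ENNReal.toReal_nonneg ?_ ?_)
    · exact (ENNReal.ofReal_le_iff_le_toReal hAB).1
        ((ofReal_le_diam hx'.1 hy'.1).trans (le_max_left _ _))
    · exact (ENNReal.ofReal_le_iff_le_toReal hAB).1
        ((ofReal_le_diam (show T^[M] x ∈ V i.2 from hx'.2) hy'.2).trans (le_max_right _ _))
  · rw [Finset.sum_mul_sum, ← Finset.univ_product_univ, Finset.sum_product]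
    refine Finset.sum_le_sum fun i _ => Finset.sum_le_sum fun j _ => iSup_le fun hne => ?_
    obtain ⟨x, hxU, hxV⟩ := hne
    rw [iSup_pos ⟨x, hxU⟩, iSup_pos ⟨_, hxV⟩, ← ENNReal.ofReal_mul (by positivity),
      ← Real.rpow_add (by positivity)]
    refine ENNReal.ofReal_le_ofReal
      (Real.rpow_le_rpow_of_exponent_le ((one_le_div hε).2 hε1) ?_)
    refine csSup_le ⟨_, mem_image_of_mem _ ⟨hxU, hxV⟩⟩ ?_
    rintro _ ⟨y, ⟨hyU, hyV⟩, rfl⟩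
    rw [birkhoffSum_add]
    exact add_le_add
      (le_csSup ((hb M).mono (image_subset_range _ _)) (mem_image_of_mem _ hyU))
      (le_csSup ((hb N).mono (image_subset_range _ _)) (mem_image_of_mem _ hyV))

theorem limsup_dimH_le_pressure [CompactSpace X] [Nonempty X] (hd : IsCompatibleMetric d)
    (hT : Continuous T) (hφ : Continuous φ) (hε : 0 < ε) (hε1 : ε < 1) :
    limsup (fun N : ℕ => dimH (dynMetric d T N) (birkhoffSum T φ N) ε / (N : EReal)) atTop ≤
      pressure d T φ ε / ((Real.logb 2 (1 / ε) : ℝ) : EReal) := by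
  have hb : ∀ N, BddAbove (range (birkhoffSum T φ N)) := fun N =>
    (isCompact_range (continuous_birkhoffSum hT hφ N)).bddAbove
  obtain ⟨C, hC⟩ := (isCompact_range hφ).bddBelow
  have hC' : ∀ (N : ℕ) x, (N : ℝ) * C ≤ birkhoffSum T φ N x := fun N x => by
    have := Finset.card_nsmul_le_sum (Finset.range N) (fun k => φ (T^[k] x)) C
      fun k _ => hC (mem_range_self _)
    simpa [birkhoffSum] using this
  set c : ℕ → ℝ≥0∞ := fun N => coveringNumber (dynMetric d T N) (birkhoffSum T φ N) ε with hc
  have hctop : ∀ N, c N ≠ ⊤ := fun N =>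
    (coveringNumber_lt_top (exists_open_cover_dynMetric hd hT N hε)).ne
  have hcle : ∀ N : ℕ, ENNReal.ofReal ((1 / ε) ^ ((N : ℝ) * C)) ≤ c N := fun N =>
    le_coveringNumber hε hε1.le (hC' N) (hb N)
  have hc0 : ∀ N, c N ≠ 0 := fun N =>
    ((ENNReal.ofReal_pos.2 (Real.rpow_pos_of_pos (by positivity) _)).trans_le (hcle N)).ne'
  have hcpos : ∀ N, 0 < (c N).toReal := fun N => ENNReal.toReal_pos (hc0 N) (hctop N)
  set u : ℕ → ℝ := fun N => Real.logb 2 (c N).toReal with hu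
  set l : ℝ := Real.logb 2 (1 / ε) with hl
  have hlpos : 0 < l := Real.logb_pos one_lt_two (by rwa [lt_div_iff₀ hε, one_mul])
  have hsub : Subadditive u := fun M N => by
    rw [hu]
    dsimp only
    rw [← Real.logb_mul (hcpos M).ne' (hcpos N).ne', ← ENNReal.toReal_mul]
    refine Real.logb_le_logb_of_le one_lt_two (hcpos _) (ENNReal.toReal_mono
      (ENNReal.mul_ne_top (hctop M) (hctop N)) ?_)
    exact coveringNumber_add_le hT hε hε1.le hb M N (hctop M) (hctop N)
  have hbdd : BddBelow (range fun n => u n / n) := by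
    -- The bound `C * l` comes from `φ ≥ C`; the `0` covers the junk value `u 0 / 0 = 0`.
    refine ⟨min 0 (C * l), ?_⟩
    rintro _ ⟨N, rfl⟩
    rcases Nat.eq_zero_or_pos N with rfl | hN
    · simp
    · have hN' : (0 : ℝ) < N := Nat.cast_pos.2 hN
      refine (min_le_right _ _).trans ?_
      dsimp only
      rw [le_div_iff₀ hN']
      have h1 : (1 / ε) ^ ((N : ℝ) * C) ≤ (c N).toReal :=
        (ENNReal.ofReal_le_iff_le_toReal (hctop N)).1 (hcle N)
      have h2 := Real.logb_le_logb_of_le one_lt_two (Real.rpow_pos_of_pos (by positivity) _) h1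
      rw [Real.logb_rpow_eq_mul_logb_of_pos (by positivity)] at h2
      calc C * l * N = N * C * l := by ring
        _ ≤ u N := h2
  have hlim := hsub.tendsto_lim hbdd
  have hpress : pressure d T φ ε = ((hsub.lim : ℝ) : EReal) := by
    have h : Tendsto (fun N : ℕ => ((u N / N : ℝ) : EReal)) atTop (𝓝 ((hsub.lim : ℝ) : EReal)) :=
      (continuous_coe_real_ereal.tendsto _).comp hlim
    rw [← h.liminf_eq, pressure]
    congr 1
    ext N
    rw [log₂_eq_coe_logb (hc0 N) (hctop N), EReal.coe_div, EReal.coe_natCast]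
  have hlim' : Tendsto (fun N : ℕ => ((u N / l / N : ℝ) : EReal)) atTop
      (𝓝 ((hsub.lim / l : ℝ) : EReal)) := by
    refine (continuous_coe_real_ereal.tendsto _).comp ?_
    simpa only [div_right_comm] using hlim.div_const l
  rw [hpress, ← EReal.coe_div, ← hlim'.limsup_eq]
  refine limsup_le_limsup (Eventually.of_forall fun N => ?_)
  dsimp only
  rw [EReal.coe_div _ (N : ℝ), EReal.coe_natCast]
  exact EReal.div_le_div_right_of_nonneg (Nat.cast_nonneg' _)
    (dimH_le_log_coveringNumber hε hε1 (hc0 N) (hctop N))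

theorem mdimH_le_lowerMdimM [CompactSpace X] [Nonempty X] (hd : IsCompatibleMetric d)
    (hT : Continuous T) (hφ : Continuous φ) : mdimH d T φ ≤ lowerMdimM d T φ := by
  -- Fix `ε₀`: its Hausdorff term is below those of all smaller `ε`, hence below the liminf on the
  -- right.
  refine limsup_le_of_le (h := ?_)
  filter_upwards [self_mem_nhdsWithin] with ε₀ hε₀
  refine le_liminf_of_le (h := ?_)
  filter_upwards [Ioo_mem_nhdsGT (lt_min hε₀ one_pos)] with ε hε
  obtain ⟨hε2, hε3⟩ := lt_min_iff.1 hε.2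
  exact (limsup_dimH_anti hε2.le).trans (limsup_dimH_le_pressure hd hT hφ hε.1 hε3)

end Dynamics

/-! ### Width dimension from the nerve of a family of weights. -/

section Nerve

variable {ι : Type*} {n : ℕ}

/-- The nerve of the cover of `X` by the supports of the functions `w i`, realized in the standard
simplex of `ℝⁿ`. -/
noncomputable def nerve (e : ι ≃ Fin n) (w : ι → X → ℝ) :
    Geometry.SimplicialComplex ℝ (Fin n → ℝ) :=
  .ofAffineIndependent
    { faces := {s | s.Nonempty ∧ ∃ x, ∀ v ∈ s, ∃ i, 0 < w i x ∧ v = Pi.single (e i) 1}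
      isRelLowerSet_faces := fun s ⟨hs, x, hx⟩ =>
        ⟨hs, fun t ht hne => ⟨hne, x, fun v hv => hx v (ht hv)⟩⟩ } <| by
    refine (Pi.basisFun ℝ (Fin n)).linearIndependent.affineIndependent.range.mono ?_
    refine iUnion₂_subset ?_
    rintro s ⟨-, x, hx⟩ v hv
    obtain ⟨i, -, rfl⟩ := hx v hv
    exact ⟨e i, Pi.basisFun_apply _ _ _⟩

theorem mem_nerve_faces {e : ι ≃ Fin n} {w : ι → X → ℝ} {s : Finset (Fin n → ℝ)} :
    s ∈ (nerve e w).faces ↔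
      s.Nonempty ∧ ∃ x, ∀ v ∈ s, ∃ i, 0 < w i x ∧ v = Pi.single (e i) 1 :=
  Iff.rfl

theorem nerve_faces_finite (e : ι ≃ Fin n) (w : ι → X → ℝ) : (nerve e w).faces.Finite := by
  classical
  refine (Finset.finite_toSet
    (Finset.univ.image fun j : Fin n => (Pi.single j 1 : Fin n → ℝ)).powerset).subset ?_
  rintro s ⟨-, x, hx⟩
  refine Finset.mem_coe.2 (Finset.mem_powerset.2 fun v hv => ?_)
  obtain ⟨i, -, rfl⟩ := hx v hv
  exact Finset.mem_image_of_mem _ (Finset.mem_univ _)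

/-- A point of the convex hull of standard basis vectors vanishes at the other coordinates. -/
theorem single_mem_of_mem_convexHull {s : Set (Fin n → ℝ)}
    (hs : ∀ v ∈ s, ∃ i : Fin n, v = Pi.single i 1) {p : Fin n → ℝ} (hp : p ∈ convexHull ℝ s)
    {j : Fin n} (hj : p j ≠ 0) : Pi.single j 1 ∈ s := by
  by_contra hjs
  refine hj (convexHull_min (t := {p : Fin n → ℝ | p j = 0}) ?_ ?_ hp)
  · intro v hv
    obtain ⟨i, rfl⟩ := hs v hv
    have : j ≠ i := by rintro rfl; exact hjs hv
    simp [this]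
  · intro p hp q hq a b _ _ _
    simp_all

variable [TopologicalSpace X] [Fintype ι]

/-- The normalized weights are barycentric coordinates of a map to the nerve. A face containing the
image of `x` may come from weights active at another point `y`, but it contains every vertex active
at `x`; so `x` and `y` share an active weight, which is why `hB` involves two points. The `+ 1` is
the difference between vertex count and dimension. -/
theorem widim_le_of_weights {D : X → X → ℝ} {ψ : X → ℝ} {a ε B : ℝ} {w : ι → X → ℝ}
    (hw : ∀ i, Continuous (w i)) (hw0 : ∀ i x, 0 ≤ w i x) (hpos : ∀ x, ∃ i, 0 < w i x)
    (haε : a < ε) (hε : 0 < ε) (hD : ∀ i x y, 0 < w i x → 0 < w i y → D x y ≤ a)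
    (hB : ∀ i x y, 0 < w i x → 0 < w i y →
      ((Finset.univ.filter fun j => 0 < w j y).card : ℝ) + ψ x ≤ B + 1) :
    widim D ψ ε ≤ (B : EReal) := by
  classical
  let e := Fintype.equivFin ι
  let W : X → ℝ := fun x => ∑ i, w i x
  have hW : ∀ x, 0 < W x := fun x => by
    obtain ⟨i, hi⟩ := hpos x
    exact Finset.sum_pos' (fun i _ => hw0 i x) ⟨i, Finset.mem_univ i, hi⟩
  let f : X → Fin (Fintype.card ι) → ℝ := fun x j => w (e.symm j) x / W x
  have hfpos : ∀ x j, f x j ≠ 0 → 0 < w (e.symm j) x := fun x j h =>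
    (hw0 _ x).lt_of_ne' fun h0 => h (by simp [f, h0])
  have hfW : Continuous W := continuous_finsetSum _ fun i _ => hw i
  have hf : Continuous f := continuous_pi fun j => (hw _).div hfW fun x => (hW x).ne'
  have hfP : ∀ x, f x ∈ (nerve e w).space := by
    intro x
    let A := Finset.univ.filter fun i => 0 < w i x
    refine Geometry.SimplicialComplex.mem_space_iff.2
      ⟨A.image fun i => Pi.single (e i) 1, mem_nerve_faces.2 ⟨?_, x, ?_⟩, ?_⟩
    · obtain ⟨i, hi⟩ := hpos x
      exact ⟨_, Finset.mem_image_of_mem _ (Finset.mem_filter.2 ⟨Finset.mem_univ i, hi⟩)⟩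
    · intro v hv
      obtain ⟨i, hi, rfl⟩ := Finset.mem_image.1 hv
      exact ⟨i, (Finset.mem_filter.1 hi).2, rfl⟩
    · have hsumA : ∑ i ∈ A, w i x = W x := Finset.sum_filter_of_ne fun i _ hi =>
        (hw0 i x).lt_of_ne' hi
      have hfx : f x = ∑ i ∈ A, (w i x / W x) • (Pi.single (e i) 1 : Fin _ → ℝ) := by
        rw [Finset.sum_filter_of_ne fun i _ hi => (hw0 i x).lt_of_ne' fun h0 => hi (by simp [h0])]
        ext j
        rw [Finset.sum_apply, Finset.sum_eq_single (e.symm j)]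
        · simp [f]
        · intro i _ hi
          have : j ≠ e i := by rintro rfl; simp at hi
          simp [this]
        · simp
      rw [hfx]
      refine (convex_convexHull ℝ _).sum_mem (fun i _ => div_nonneg (hw0 i x) (hW x).le) ?_
        fun i hi => subset_convexHull ℝ _ (Finset.mem_coe.2 (Finset.mem_image_of_mem _ hi))
      rw [← Finset.sum_div, hsumA, div_self (hW x).ne']
  let F : C(X, (nerve e w).space) := ⟨fun x => ⟨f x, hfP x⟩, hf.subtype_mk _⟩
  have hF : IsEpsEmbedding D ε F := by
    intro p
    refine diam_lt_ofReal haε hε fun x hx y hy => ?_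
    obtain ⟨i, hi⟩ := hpos x
    have hxy : f x = f y := congrArg Subtype.val
      ((mem_singleton_iff.1 hx).trans (mem_singleton_iff.1 hy).symm)
    refine hD i x y hi ?_
    have h1 : f y (e i) ≠ 0 := by
      rw [← hxy]
      simpa [f] using ⟨hi.ne', (hW x).ne'⟩
    simpa using hfpos y (e i) h1
  refine (iInf₂_le (Fintype.card ι) (nerve e w)).trans
    ((iInf₂_le (nerve_faces_finite e w) F).trans (iInf_le_of_le hF ?_))
  refine iSup_le fun x => EReal.coe_le_coe_iff.2 ?_
  have hdim : (localDim (nerve e w) (f x) : ℝ) ≤ B - ψ x := by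
    have hmem : ∀ k ∈ {k : ℕ | ∃ s ∈ (nerve e w).faces,
        f x ∈ convexHull ℝ (s : Set (Fin (Fintype.card ι) → ℝ)) ∧ s.card = k + 1},
        (k : ℝ) ≤ B - ψ x := by
      rintro k ⟨s, ⟨-, y, hy⟩, hxs, hk⟩
      obtain ⟨i, hi⟩ := hpos x
      have hix : f x (e i) ≠ 0 := by simpa [f] using ⟨hi.ne', (hW x).ne'⟩
      have his := single_mem_of_mem_convexHull (fun v hv => by
        obtain ⟨i, -, h⟩ := hy v hv
        exact ⟨e i, h⟩) hxs hix
      obtain ⟨i', hi', hii'⟩ := hy _ his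
      obtain rfl : i = i' := by
        have := congrFun hii' (e i)
        rw [Pi.single_eq_same] at this
        by_contra hne
        rw [Pi.single_eq_of_ne fun h => hne (e.injective h)] at this
        exact one_ne_zero this
      have hcard : s.card ≤ (Finset.univ.filter fun j => 0 < w j y).card := by
        refine (Finset.card_le_card (t := (Finset.univ.filter fun j => 0 < w j y).image
          fun i => Pi.single (e i) 1) fun v hv => ?_).trans Finset.card_image_le
        obtain ⟨j, hj, rfl⟩ := hy v hv
        exact Finset.mem_image_of_mem _ (Finset.mem_filter.2 ⟨Finset.mem_univ j, hj⟩)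
      have h1 := hB i x y hi hi'
      have h2 : ((k + 1 : ℕ) : ℝ) ≤ _ := Nat.cast_le.2 (hk ▸ hcard)
      push_cast at h2
      linarith
    have hne : {k : ℕ | ∃ s ∈ (nerve e w).faces,
        f x ∈ convexHull ℝ (s : Set (Fin (Fintype.card ι) → ℝ)) ∧ s.card = k + 1}.Nonempty := by
      obtain ⟨s, hs, hxs⟩ := Geometry.SimplicialComplex.mem_space_iff.1 (hfP x)
      exact ⟨s.card - 1, s, hs, hxs, (Nat.succ_pred_eq_of_pos
        ((nerve e w).nonempty_of_mem_faces hs).card_pos).symm⟩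
    refine hmem _ (Nat.sSup_mem hne ⟨⌊B - ψ x⌋₊, fun k hk => Nat.le_floor (hmem k hk)⟩)
  change (localDim (nerve e w) (f x) : ℝ) + ψ x ≤ B
  linarith

end Nerve

/-! ### Superlevel sets in the cube. -/

section CutWeight

variable {α : Type*} [Fintype α] [DecidableEq α]

/-- A weight that is positive exactly when `S` is a superlevel set of `g`, at a level in `(0, 1)`;
for `g` in the unit cube, these sets span the simplex of the Freudenthal triangulation that
contains `g`. -/
noncomputable def cutWeight (g : α → ℝ) (S : Finset α) : ℝ :=
  (∏ a ∈ S, g a) * (∏ b ∈ Sᶜ, (1 - g b)) * ∏ a ∈ S, ∏ b ∈ Sᶜ, max 0 (g a - g b)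

theorem continuous_cutWeight (S : Finset α) : Continuous fun g : α → ℝ => cutWeight g S := by
  unfold cutWeight
  fun_prop

variable {g : α → ℝ}

theorem cutWeight_nonneg (h0 : ∀ a, 0 ≤ g a) (h1 : ∀ a, g a ≤ 1) (S : Finset α) :
    0 ≤ cutWeight g S :=
  mul_nonneg (mul_nonneg (Finset.prod_nonneg fun a _ => h0 a)
    (Finset.prod_nonneg fun a _ => sub_nonneg.2 (h1 a)))
    (Finset.prod_nonneg fun _ _ => Finset.prod_nonneg fun _ _ => le_max_left _ _)

theorem cutWeight_pos_iff (h0 : ∀ a, 0 ≤ g a) (h1 : ∀ a, g a ≤ 1) {S : Finset α} :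
    0 < cutWeight g S ↔
      (∀ a ∈ S, 0 < g a) ∧ (∀ b ∉ S, g b < 1) ∧ ∀ a ∈ S, ∀ b ∉ S, g b < g a := by
  rw [(cutWeight_nonneg h0 h1 S).lt_iff_ne', cutWeight, mul_ne_zero_iff, mul_ne_zero_iff,
    Finset.prod_ne_zero_iff, Finset.prod_ne_zero_iff, Finset.prod_ne_zero_iff, and_assoc]
  refine and_congr (forall₂_congr fun a _ => (h0 a).lt_iff_ne'.symm) (and_congr ?_ ?_)
  · simp only [Finset.mem_compl]
    refine forall₂_congr fun b _ => ?_
    rw [← (sub_nonneg.2 (h1 b)).lt_iff_ne', sub_pos]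
  · refine forall₂_congr fun a _ => ?_
    simp only [Finset.prod_ne_zero_iff, Finset.mem_compl]
    refine forall₂_congr fun b _ => ?_
    rw [← (le_max_left 0 (g a - g b)).lt_iff_ne', lt_max_iff, sub_pos]
    simp

theorem exists_cutWeight_pos (h0 : ∀ a, 0 ≤ g a) (h1 : ∀ a, g a ≤ 1) :
    ∃ S, 0 < cutWeight g S := by
  -- Any level strictly between 0 and 1 works: `{g > t}` is a superlevel set of the required kind.
  obtain ⟨t, ht, htg⟩ := (Set.Ioo_infinite (zero_lt_one (α := ℝ))).exists_notMem_finite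
    (Set.finite_range g)
  refine ⟨Finset.univ.filter fun a => t < g a, (cutWeight_pos_iff h0 h1).2 ⟨?_, ?_, ?_⟩⟩
  · intro a ha
    exact ht.1.trans (Finset.mem_filter.1 ha).2
  · intro b hb
    simp only [Finset.mem_filter, Finset.mem_univ, true_and, not_lt] at hb
    exact hb.trans_lt ht.2
  · intro a ha b hb
    simp only [Finset.mem_filter, Finset.mem_univ, true_and, not_lt] at ha hb
    exact hb.trans_lt ha

/-- The active sets form a chain, and two of them can differ only at coordinates strictly between 0
and 1. So `S` is determined by `#(S ∩ M)`, which takes at most `#M + 1` values. -/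
theorem card_cutWeight_pos_le (h0 : ∀ a, 0 ≤ g a) (h1 : ∀ a, g a ≤ 1) :
    (Finset.univ.filter fun S => 0 < cutWeight g S).card ≤
      (Finset.univ.filter fun a => 0 < g a ∧ g a < 1).card + 1 := by
  set M := Finset.univ.filter fun a => 0 < g a ∧ g a < 1 with hM
  rw [← Finset.card_range (M.card + 1)]
  refine Finset.card_le_card_of_injOn (fun S => (S ∩ M).card) (fun S _ => ?_) ?_
  · simpa [Nat.lt_succ_iff] using Finset.card_le_card Finset.inter_subset_right
  · have key : ∀ S S' : Finset α, 0 < cutWeight g S → 0 < cutWeight g S' → S ⊆ S' →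
        (S ∩ M).card = (S' ∩ M).card → S = S' := by
      intro S S' hS hS' hsub hcard
      have heq := Finset.eq_of_subset_of_card_le (Finset.inter_subset_inter_right hsub) hcard.ge
      refine hsub.antisymm fun a ha => by_contra fun haS => haS ?_
      have haM : a ∈ M := Finset.mem_filter.2 ⟨Finset.mem_univ a,
        ((cutWeight_pos_iff h0 h1).1 hS').1 a ha, ((cutWeight_pos_iff h0 h1).1 hS).2.1 a haS⟩
      exact (Finset.mem_inter.1 (heq ▸ Finset.mem_inter.2 ⟨ha, haM⟩ : a ∈ S ∩ M)).1
    intro S hS S' hS' hcard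
    replace hS := (Finset.mem_filter.1 (Finset.mem_coe.1 hS)).2
    replace hS' := (Finset.mem_filter.1 (Finset.mem_coe.1 hS')).2
    by_cases h : S ⊆ S'
    · exact key S S' hS hS' h hcard
    · refine (key S' S hS' hS (fun b hb => by_contra fun hbS => h fun a ha => ?_) hcard.symm).symm
      by_contra haS'
      exact lt_asymm (((cutWeight_pos_iff h0 h1).1 hS).2.2 a ha b hbS)
        (((cutWeight_pos_iff h0 h1).1 hS').2.2 b hb a haS')

end CutWeight

/-! ### Random thresholds and the volume estimate. -/

section Thresholds

open MeasureTheory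

variable {α : Type*} [Fintype α] {F : α → X → ℝ} {D : X → X → ℝ} {L : ℝ}

theorem volume_image_le (hL : 0 ≤ L) {f : X → ℝ} (hf : ∀ x y, |f x - f y| ≤ L * D x y)
    (E : Set X) : volume (f '' E) ≤ ENNReal.ofReal L * diam D E := by
  refine (Real.volume_le_diam _).trans (Metric.ediam_le ?_)
  rintro _ ⟨x, hx, rfl⟩ _ ⟨y, hy, rfl⟩
  rw [edist_dist, Real.dist_eq]
  refine (ENNReal.ofReal_le_ofReal (hf x y)).trans ?_
  rw [ENNReal.ofReal_mul hL]
  gcongr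
  exact ofReal_le_diam hx hy

/-- If `E` has small diameter, then few thresholds `c` are hit by many coordinates `F a` at a
common point of `E`. -/
theorem volume_hitting_le (hL : 1 ≤ L) (hF : ∀ a x y, |F a x - F a y| ≤ L * D x y) {ψ : X → ℝ}
    (hψ : BddAbove (range ψ)) {s b ε : ℝ} (hs : ∀ x, ψ x ≤ s) (hb : 0 ≤ b) (hε : 0 < ε)
    (hε1 : ε ≤ 1) (hC : (2 * L) ^ Fintype.card α * ε ^ b ≤ 1) {E : Set X}
    (hE : diam D E < ENNReal.ofReal ε) :
    volume {c : α → ℝ | (∀ a, c a ∈ Icc 1 2) ∧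
        ∃ x ∈ E, s + b ≤ ((Finset.univ.filter fun a => F a x = c a).card : ℝ) + ψ x} ≤
      ⨆ _ : E.Nonempty, diam D E ^ (s - sSup (ψ '' E)) := by
  classical
  rcases E.eq_empty_or_nonempty with rfl | hne
  · simp
  rw [iSup_pos hne]
  set t : ℝ := s - sSup (ψ '' E) with ht
  have ht0 : 0 ≤ t := sub_nonneg.2 (csSup_le (hne.image _) (by rintro _ ⟨x, -, rfl⟩; exact hs x))
  set δ := diam D E with hδ
  have hδ1 : δ ≤ 1 := hE.le.trans (by simpa using hε1)
  have hL0 : 0 ≤ L := zero_le_one.trans hL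
  -- `Q A` contains the thresholds hit by a point of `E` exactly along `A`. Only `A` with `#A ≥ t +
  -- b` matter: `δ^t` is the desired bound, and `δ^b ≤ ε^b` pays for the at most `2^#α` choices of
  -- `A` and for the Lipschitz factors.
  let Q : Finset α → Set (α → ℝ) := fun A =>
    Set.pi univ fun a => if a ∈ A then F a '' E else Icc 1 2
  let 𝒜 : Finset (Finset α) := Finset.univ.filter fun A => t + b ≤ A.card
  have hQ : ∀ A ∈ 𝒜, volume (Q A) ≤
      ENNReal.ofReal L ^ Fintype.card α * (δ ^ t * ENNReal.ofReal ε ^ b) := by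
    intro A hA
    have h1 : volume (Q A) ≤ (ENNReal.ofReal L * δ) ^ A.card := by
      have h2 : (ENNReal.ofReal L * δ) ^ A.card =
          ∏ a, if a ∈ A then ENNReal.ofReal L * δ else 1 := by simp
      rw [volume_pi_pi, h2]
      refine Finset.prod_le_prod' fun a _ => ?_
      split_ifs
      · exact volume_image_le hL0 (hF a) E
      · rw [Real.volume_Icc]; norm_num
    refine h1.trans ?_
    rw [mul_pow]
    refine mul_le_mul' (pow_le_pow_right₀ (by simpa using hL) (Finset.card_le_univ A)) ?_
    calc δ ^ A.card = δ ^ (A.card : ℝ) := (ENNReal.rpow_natCast _ _).symm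
      _ ≤ δ ^ (t + b) := ENNReal.rpow_le_rpow_of_exponent_ge hδ1 (Finset.mem_filter.1 hA).2
      _ = δ ^ t * δ ^ b := ENNReal.rpow_add_of_nonneg _ _ ht0 hb
      _ ≤ _ := mul_le_mul' le_rfl (ENNReal.rpow_le_rpow hE.le hb)
  have hsub : {c : α → ℝ | (∀ a, c a ∈ Icc 1 2) ∧
      ∃ x ∈ E, s + b ≤ ((Finset.univ.filter fun a => F a x = c a).card : ℝ) + ψ x} ⊆
      ⋃ A ∈ 𝒜, Q A := by
    rintro c ⟨hc, x, hx, hcx⟩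
    refine mem_iUnion₂.2 ⟨Finset.univ.filter fun a => F a x = c a,
      Finset.mem_filter.2 ⟨Finset.mem_univ _, ?_⟩, fun a _ => ?_⟩
    · have := le_csSup (hψ.mono (image_subset_range _ E)) (mem_image_of_mem ψ hx)
      rw [ht]
      linarith
    · by_cases h : F a x = c a
      · simpa [h] using ⟨x, hx, h⟩
      · simpa [h] using hc a
  have hC' : (2 * ENNReal.ofReal L) ^ Fintype.card α * ENNReal.ofReal ε ^ b ≤ 1 := by
    rw [ENNReal.ofReal_rpow_of_pos hε, ← ENNReal.ofReal_ofNat 2, ← ENNReal.ofReal_mul zero_le_two,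
      ← ENNReal.ofReal_pow (by positivity), ← ENNReal.ofReal_mul (by positivity)]
    simpa using hC
  calc _ ≤ volume (⋃ A ∈ 𝒜, Q A) := measure_mono hsub
    _ ≤ ∑ A ∈ 𝒜, volume (Q A) := measure_biUnion_finset_le _ _
    _ ≤ ∑ A ∈ 𝒜, ENNReal.ofReal L ^ Fintype.card α * (δ ^ t * ENNReal.ofReal ε ^ b) :=
      Finset.sum_le_sum hQ
    _ ≤ 2 ^ Fintype.card α *
        (ENNReal.ofReal L ^ Fintype.card α * (δ ^ t * ENNReal.ofReal ε ^ b)) := by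
      rw [Finset.sum_const, nsmul_eq_mul]
      refine mul_le_mul' ?_ le_rfl
      have : 𝒜.card ≤ 2 ^ Fintype.card α := (Finset.card_le_univ _).trans_eq Fintype.card_finset
      exact_mod_cast this
    _ = (2 * ENNReal.ofReal L) ^ Fintype.card α * ENNReal.ofReal ε ^ b * δ ^ t := by ring
    _ ≤ 1 * δ ^ t := mul_le_mul' hC' le_rfl
    _ = δ ^ t := one_mul _

/-- If every `c` were bad, the bad sets of the cover members would cover a box of volume 1, while
their volumes sum to less than 1. -/
theorem exists_thresholds (hL : 1 ≤ L) (hF : ∀ a x y, |F a x - F a y| ≤ L * D x y) {ψ : X → ℝ}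
    (hψ : BddAbove (range ψ)) {s b ε : ℝ} (hs : ∀ x, ψ x ≤ s) (hb : 0 ≤ b) (hε : 0 < ε)
    (hε1 : ε ≤ 1) (hC : (2 * L) ^ Fintype.card α * ε ^ b ≤ 1)
    (hH : hausdorffContent D ψ s ε < 1) :
    ∃ c : α → ℝ, (∀ a, c a ∈ Icc 1 2) ∧
      ∀ x, ((Finset.univ.filter fun a => F a x = c a).card : ℝ) + ψ x < s + b := by
  simp only [hausdorffContent, iInf_lt_iff] at hH
  obtain ⟨E, hcov, hdiam, hsum⟩ := hH
  by_contra! hcon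
  have hbox : volume (Set.pi univ fun _ : α => Icc (1 : ℝ) 2) = 1 := by
    rw [volume_pi_pi]
    simp [Real.volume_Icc, show (2 : ℝ) - 1 = 1 by norm_num]
  refine lt_irrefl (1 : ℝ≥0∞) (lt_of_le_of_lt ?_ hsum)
  refine hbox.symm.le.trans ((measure_mono fun c hc => ?_).trans ((measure_iUnion_le _).trans
    (ENNReal.tsum_le_tsum fun i =>
      volume_hitting_le hL hF hψ hs hb hε hε1 hC (hdiam i))))
  have hc' : ∀ a, c a ∈ Icc (1 : ℝ) 2 := fun a => hc a (mem_univ a)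
  obtain ⟨x, hx⟩ := hcon c hc'
  obtain ⟨i, hi⟩ := mem_iUnion.1 (hcov.symm ▸ mem_univ x : x ∈ ⋃ i, E i)
  exact mem_iUnion.2 ⟨i, hc', x, hi, hx⟩

/-- A coordinate that misses its threshold at `y` stays away from it near `y`, so the count is upper
semicontinuous; compactness makes the width `δ` uniform. -/
theorem eventually_card_near_add_lt [TopologicalSpace X] [CompactSpace X]
    (hF : ∀ a, Continuous (F a)) {ψ : X → ℝ} (hψ : Continuous ψ) {c : α → ℝ} {B : ℝ}
    (h : ∀ x, ((Finset.univ.filter fun a => F a x = c a).card : ℝ) + ψ x < B) :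
    ∀ᶠ δ in 𝓝 (0 : ℝ),
      ∀ x, ((Finset.univ.filter fun a => |F a x - c a| < δ).card : ℝ) + ψ x < B := by
  have := (isCompact_univ (X := X)).eventually_forall_of_forall_eventually (x₀ := (0 : ℝ))
    (P := fun δ x => ((Finset.univ.filter fun a => |F a x - c a| < δ).card : ℝ) + ψ x < B) ?_
  · simpa using this
  intro y _
  have h1 : ∀ᶠ z : ℝ × X in 𝓝 (0, y), ∀ a, F a y ≠ c a → z.1 < |F a z.2 - c a| := by
    refine eventually_all.2 fun a => ?_
    by_cases hne : F a y = c a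
    · simp [hne]
    · have hopen : IsOpen {z : ℝ × X | z.1 < |F a z.2 - c a|} :=
        isOpen_lt continuous_fst (((hF a).comp continuous_snd).sub continuous_const).abs
      filter_upwards [hopen.mem_nhds (show (0 : ℝ) < |F a y - c a| from
        abs_pos.2 (sub_ne_zero.2 hne))] with z hz _ using hz
  have h2 : ∀ᶠ z : ℝ × X in 𝓝 (0, y),
      ((Finset.univ.filter fun a => F a y = c a).card : ℝ) + ψ z.2 < B :=
    (isOpen_lt (continuous_const.add (hψ.comp continuous_snd)) continuous_const).mem_nhds (h y)
  filter_upwards [h1, h2] with z hz1 hz2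
  refine lt_of_le_of_lt (add_le_add_left (Nat.cast_le.2 (Finset.card_le_card fun a ha => ?_)) _) hz2
  simp only [Finset.mem_filter, Finset.mem_univ, true_and] at ha ⊢
  by_contra hne
  exact lt_asymm ha (hz1 a hne)

end Thresholds

/-! ### From thresholds to width dimension; the first inequality. -/

section LowerBound

variable [TopologicalSpace X] [CompactSpace X] {d d' : X → X → ℝ} {T : X → X} {φ : X → ℝ}

/-- If the thresholds `c` separate points of `X` up to the relation `D ≤ a`, and few of them are
hit at each point, then the width dimension is small. -/
theorem widim_le_of_thresholds {α : Type*} [Fintype α] {F : α → X → ℝ} {D : X → X → ℝ}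
    {ψ : X → ℝ} (hF : ∀ a, Continuous (F a)) (hψ : Continuous ψ) {c : α → ℝ}
    (hc : ∀ a, c a ∈ Icc 1 2) {a ε η B : ℝ}
    (h : ∀ x, ((Finset.univ.filter fun a => F a x = c a).card : ℝ) + ψ x < B)
    (haε : a < ε) (hε : 0 < ε)
    (hD : ∀ x y, (∀ a, F a y < 1 / 2 → F a x < 3) → D x y ≤ a)
    (hη : ∀ x y, (∀ a, F a y < 1 / 2 → F a x < 3) → ψ x ≤ ψ y + η) :
    widim D ψ ε ≤ ((B + η : ℝ) : EReal) := by
  classical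
  -- With `δ < 1/2` and `c a ∈ [1, 2]`, each window `(c a - δ, c a + δ)` lies in `(1/2, 5/2)`, so `F
  -- a < 1/2` forces `G = 0` and `F a ≥ 3` forces `G = 1`.
  obtain ⟨δ, hδ, hδ0, hδ2⟩ := ((eventually_card_near_add_lt hF hψ h).filter_mono
    nhdsWithin_le_nhds |>.and (Ioo_mem_nhdsGT (show (0 : ℝ) < 1 / 2 by norm_num))).exists
  let G : X → α → ℝ := fun x a => max 0 (min 1 ((F a x - c a) / (2 * δ) + 1 / 2))
  have hG : Continuous G := continuous_pi fun a => continuous_const.max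
    (continuous_const.min ((((hF a).sub continuous_const).div_const _).add continuous_const))
  have hG0 : ∀ x a, 0 ≤ G x a := fun x a => le_max_left _ _
  have hG1 : ∀ x a, G x a ≤ 1 := fun x a => max_le zero_le_one (min_le_left _ _)
  have hGpos : ∀ x a, 0 < G x a → c a - δ < F a x := by
    intro x a hx
    have h1 := ((lt_max_iff.1 hx).resolve_left (lt_irrefl _)).trans_le (min_le_right _ _)
    rw [div_add' _ _ _ (by positivity), lt_div_iff₀ (by positivity)] at h1
    linarith
  have hGlt : ∀ x a, G x a < 1 → F a x < c a + δ := by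
    intro x a hx
    have h1 := (min_lt_iff.1 ((le_max_right _ _).trans_lt hx)).resolve_left (lt_irrefl _)
    rw [div_add' _ _ _ (by positivity), div_lt_iff₀ (by positivity)] at h1
    linarith
  have hshare : ∀ S x y, 0 < cutWeight (G x) S → 0 < cutWeight (G y) S →
      ∀ a, F a y < 1 / 2 → F a x < 3 := by
    intro S x y hx hy a ha
    have haS : a ∉ S := fun haS => by
      have := hGpos y a (((cutWeight_pos_iff (hG0 y) (hG1 y)).1 hy).1 a haS)
      linarith [(hc a).1]
    have := hGlt x a (((cutWeight_pos_iff (hG0 x) (hG1 x)).1 hx).2.1 a haS)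
    linarith [(hc a).2]
  refine widim_le_of_weights (w := fun S x => cutWeight (G x) S) (a := a)
    (fun S => (continuous_cutWeight S).comp hG)
    (fun S x => cutWeight_nonneg (hG0 x) (hG1 x) S)
    (fun x => exists_cutWeight_pos (hG0 x) (hG1 x)) haε hε
    (fun S x y hx hy => hD x y (hshare S x y hx hy)) fun S x y hx hy => ?_
  have h1 := hη x y (hshare S x y hx hy)
  have h2 : ((Finset.univ.filter fun S => 0 < cutWeight (G y) S).card : ℝ) ≤
      (Finset.univ.filter fun a => |F a y - c a| < δ).card + 1 := by
    refine (Nat.cast_le.2 (card_cutWeight_pos_le (hG0 y) (hG1 y))).trans ?_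
    push_cast
    refine add_le_add_left (Nat.cast_le.2 (Finset.card_le_card fun a ha => ?_)) _
    simp only [Finset.mem_filter, Finset.mem_univ, true_and] at ha ⊢
    rw [abs_lt]
    constructor <;> linarith [hGpos y a ha.1, hGlt y a ha.2]
  have h3 := hδ y
  linarith

/-- The point is that `ε'` depends on neither `N` nor `s`. Half of `κ * N` pays for the choice of
thresholds, half for the oscillation of the Birkhoff sum. -/
theorem exists_forall_widim_le (hd : IsCompatibleMetric d) (hd' : IsCompatibleMetric d')
    (hT : Continuous T) (hφ : Continuous φ) {ε κ : ℝ} (hε : 0 < ε) (hκ : 0 < κ) :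
    ∃ ε' > 0, ∀ (N : ℕ) (s : ℝ), (∀ x, birkhoffSum T φ N x ≤ s) →
      hausdorffContent (dynMetric d T N) (birkhoffSum T φ N) s ε' < 1 →
      widim (dynMetric d' T N) (birkhoffSum T φ N) ε ≤ ((s + κ * N : ℝ) : EReal) := by
  classical
  obtain ⟨ρ₁, hρ₁, h₁⟩ := hd.exists_forall_lt hd'.continuous_uncurry hd'.self_eq_zero (half_pos hε)
  obtain ⟨ρ₂, hρ₂, h₂⟩ := hd.exists_forall_lt (u := fun p => φ p.1 - φ p.2)
    ((hφ.comp continuous_fst).sub (hφ.comp continuous_snd)) (fun x => sub_self _) (half_pos hκ)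
  -- The factor 4 suffices since points with `F < 3` and `F < 1/2` for a common net point are less
  -- than `3r + r/2` apart.
  obtain ⟨r, hr0, hr1, hr⟩ : ∃ r > 0, r ≤ 1 ∧ 4 * r ≤ min ρ₁ ρ₂ := by
    have := lt_min hρ₁ hρ₂
    exact ⟨min 1 (min ρ₁ ρ₂ / 4), by positivity, min_le_left _ _, by
      linarith [min_le_right 1 (min ρ₁ ρ₂ / 4)]⟩
  obtain ⟨t, ht⟩ := hd.exists_finset_net (half_pos hr0)
  have hL : 1 ≤ 1 / r := (one_le_div hr0).2 hr1
  have hC1 : 1 ≤ (2 * (1 / r)) ^ t.card := one_le_pow₀ (by linarith)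
  set C := (2 * (1 / r)) ^ t.card with hC
  have hC0 : 0 < C := zero_lt_one.trans_le hC1
  -- Chosen so that `ε' ^ (κ / 2) = C⁻¹`, which cancels the factor `C` incurred per time step.
  refine ⟨C⁻¹ ^ (κ / 2)⁻¹, by positivity, fun N s hs hH => ?_⟩
  set ε' := C⁻¹ ^ (κ / 2)⁻¹ with hε'
  have hε'0 : 0 < ε' := by positivity
  have hε'1 : ε' ≤ 1 := Real.rpow_le_one (by positivity) (inv_le_one_of_one_le₀ hC1) (by positivity)
  have hε'C : ε' ^ (κ / 2) = C⁻¹ := Real.rpow_inv_rpow (by positivity) (by positivity)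
  let F : t × Fin N → X → ℝ := fun p x => d (T^[p.2] x) p.1 / r
  have hFc : ∀ p, Continuous (F p) := fun p =>
    (hd.continuous_uncurry.comp ((hT.iterate p.2).prodMk continuous_const)).div_const _
  have hF : ∀ p x y, |F p x - F p y| ≤ 1 / r * dynMetric d T N x y := by
    intro p x y
    have h1 := le_dynMetric (d := d) T p.2.2 x y
    have h2 := hd.triangle (T^[p.2] x) (T^[p.2] y) p.1
    have h3 := hd.triangle (T^[p.2] y) (T^[p.2] x) p.1
    rw [hd.symm (T^[p.2] y) (T^[p.2] x)] at h3
    rw [← sub_div, abs_div, abs_of_pos hr0, one_div, inv_mul_eq_div]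
    gcongr
    rw [abs_le]
    constructor <;> linarith
  have hψ := continuous_birkhoffSum hT hφ N
  have hcard : (2 * (1 / r)) ^ Fintype.card (t × Fin N) * ε' ^ (κ / 2 * N) ≤ 1 := by
    rw [Fintype.card_prod, Fintype.card_coe, Fintype.card_fin, pow_mul, ← hC,
      Real.rpow_mul_natCast hε'0.le, hε'C, ← mul_pow, mul_inv_cancel₀ hC0.ne', one_pow]
  obtain ⟨c, hc, hcs⟩ := exists_thresholds hL hF (isCompact_range hψ).bddAbove hs
    (by positivity) hε'0 hε'1 hcard hH
  have hnear : ∀ x y, (∀ p, F p y < 1 / 2 → F p x < 3) →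
      ∀ n < N, d (T^[n] x) (T^[n] y) < min ρ₁ ρ₂ := by
    intro x y hxy n hn
    obtain ⟨z, hz, hyz⟩ := ht (T^[n] y)
    have h1 : d (T^[n] x) z / r < 3 := hxy (⟨z, hz⟩, ⟨n, hn⟩) (by
      change d (T^[n] y) z / r < 1 / 2
      rw [div_lt_iff₀ hr0]
      linarith)
    rw [div_lt_iff₀ hr0] at h1
    have h2 := hd.triangle (T^[n] x) z (T^[n] y)
    rw [hd.symm z] at h2
    linarith
  have hmain := widim_le_of_thresholds (D := dynMetric d' T N) (η := κ / 2 * N) hFc hψ hc hcs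
    (half_lt_self hε) hε
    (fun x y hxy => dynMetric_le T (by positivity) fun n hn =>
      (h₁ _ _ ((hnear x y hxy n hn).trans_le (min_le_left _ _))).le)
    (fun x y hxy => by
      have : birkhoffSum T φ N x - birkhoffSum T φ N y ≤ ∑ _n ∈ Finset.range N, κ / 2 := by
        rw [birkhoffSum, birkhoffSum, ← Finset.sum_sub_distrib]
        exact Finset.sum_le_sum fun n hn =>
          (h₂ _ _ ((hnear x y hxy n (Finset.mem_range.1 hn)).trans_le (min_le_right _ _))).le
      rw [Finset.sum_const, Finset.card_range, nsmul_eq_mul] at this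
      linarith)
  refine hmain.trans_eq ?_
  congr 1
  ring

/-- At `s = max ψ`, a cover member containing a maximum point has exponent 0 and contributes 1, even
when its diameter is 0. This makes any `s` above `dimH` admissible in `hausdorffContent`. -/
theorem le_dimH [Nonempty X] {D : X → X → ℝ} {ψ : X → ℝ} (hψ : Continuous ψ) (ε : ℝ) (x : X) :
    (ψ x : EReal) ≤ dimH D ψ ε := by
  obtain ⟨z, -, hz⟩ := (isCompact_univ (X := X)).exists_isMaxOn univ_nonempty hψ.continuousOn
  have hz' : ∀ y, ψ y ≤ ψ z := fun y => hz (mem_univ y)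
  refine (EReal.coe_le_coe_iff.2 (hz' x)).trans
    (le_iSup_of_le (ψ z) (le_iSup₂_of_le hz' ?_ le_rfl))
  refine le_iInf₂ fun E hcov => le_iInf fun _ => ?_
  obtain ⟨i, hi⟩ := mem_iUnion.1 (hcov.symm ▸ mem_univ z : z ∈ ⋃ i, E i)
  refine le_trans ?_ (ENNReal.le_tsum i)
  have hsup : sSup (ψ '' E i) = ψ z :=
    IsGreatest.csSup_eq ⟨mem_image_of_mem _ hi, by rintro _ ⟨y, -, rfl⟩; exact hz' y⟩
  rw [iSup_pos ⟨z, hi⟩, hsup, sub_self, ENNReal.rpow_zero]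

theorem mdim_le_mdimH [Nonempty X] (hd : IsCompatibleMetric d) (hd' : IsCompatibleMetric d')
    (hT : Continuous T) (hφ : Continuous φ) : mdim d' T φ ≤ mdimH d T φ := by
  refine EReal.le_of_forall_lt_iff_le.1 fun z hz => ?_
  -- The gap `z - y` is the slope `κ` of the allowed loss.
  obtain ⟨y, hy, hyz⟩ := EReal.lt_iff_exists_real_btwn.1 hz
  have hyz' : y < z := EReal.coe_lt_coe_iff.1 hyz
  refine limsup_le_of_le (h := ?_)
  filter_upwards [self_mem_nhdsWithin] with ε hε
  obtain ⟨ε', hε', hwidim⟩ := exists_forall_widim_le hd hd' hT hφ hε (sub_pos.2 hyz')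
  have hlt : limsup (fun N : ℕ =>
      dimH (dynMetric d T N) (birkhoffSum T φ N) ε' / (N : EReal)) atTop < y := by
    refine lt_of_le_of_lt (le_limsup_of_frequently_le (Eventually.frequently ?_)) hy
    filter_upwards [Ioo_mem_nhdsGT hε'] with ε'' h
    exact limsup_dimH_anti h.2.le
  refine limsup_le_of_le (h := ?_)
  filter_upwards [eventually_lt_of_limsup_lt hlt, eventually_gt_atTop 0] with N hN hN0
  have hN0' : (0 : EReal) < N := by exact_mod_cast hN0
  have hNtop : (N : EReal) ≠ ⊤ := EReal.natCast_ne_top N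
  rw [EReal.div_lt_iff hN0' hNtop] at hN
  have hN' : dimH (dynMetric d T N) (birkhoffSum T φ N) ε' < ((y * N : ℝ) : EReal) := by
    rwa [EReal.coe_mul, EReal.coe_natCast]
  have hs : ∀ x, birkhoffSum T φ N x ≤ y * N := fun x => EReal.coe_le_coe_iff.1
    ((le_dimH (continuous_birkhoffSum hT hφ N) ε' x).trans hN'.le)
  have hH : hausdorffContent (dynMetric d T N) (birkhoffSum T φ N) (y * N) ε' < 1 :=
    lt_of_not_ge fun h => hN'.not_ge (le_iSup_of_le (y * N) (le_iSup₂_of_le hs h le_rfl))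
  rw [EReal.div_le_iff_le_mul hN0' hNtop]
  refine (hwidim N _ hs hH).trans_eq ?_
  rw [← EReal.coe_natCast, ← EReal.coe_mul]
  congr 1
  ring

end LowerBound

end MeanDim

/-- `mdim(X, T, φ)` is a topological invariant: it may be computed with any compatible metric `d'`,
independently of the metric `d` used for the other two quantities. -/
theorem theorem1p6 {X : Type*} [TopologicalSpace X] [CompactSpace X] [Nonempty X]
    (d : X → X → ℝ) (hd : MeanDim.IsCompatibleMetric d)
    (d' : X → X → ℝ) (hd' : MeanDim.IsCompatibleMetric d')
    (T : X ≃ₜ X) (φ : X → ℝ) (hφ : Continuous φ) :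
    MeanDim.mdim d' T φ ≤ MeanDim.mdimH d T φ ∧
      MeanDim.mdimH d T φ ≤ MeanDim.lowerMdimM d T φ :=
  ⟨MeanDim.mdim_le_mdimH hd hd' T.continuous hφ,
    MeanDim.mdimH_le_lowerMdimM hd T.continuous hφ⟩
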